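/- Let $F$ be a field with $\operatorname{char}(F)\neq 2$ and let $A$ be an associative (not necessarily unital) $F$-algebra with center $Z(A)$. Suppose that $A$ is noncommutative and prime, i.e., the product of any two nonzero (two-sided) ideals of $A$ is nonzero. Suppose that $M$ is the unique minimal ideal of $A$, i.e., a nonzero ideal of $A$ that is contained in every nonzero ideal of $A$. Write $[x,y]=xy-yx$, and let $[M,A]$ be the linear span of all $[m,a]$ with $m\in M$, $a\in A$. A Lie ideal of $A$ is a linear subspace $L$ of $A$ such that $[x,a]\in L$ for all $x\in L$, $a\in A$; it is noncentral if $L\not\subseteq Z(A)$. Then $[M,A]$ is the unique minimal noncentral Lie ideal of $A$, i.e., $[M,A]$ is a noncentral Lie ideal of $A$ and it is contained in every noncentral Lie ideal of $A$. -/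

import Mathlib

namespace HersteinLie

section

variable (F : Type*) {A : Type*} [Field F] [NonUnitalRing A] [Module F A]

/-- A (two-sided) ideal of a not necessarily unital `F`-algebra `A`: a subspace closed under
multiplication by elements of `A` on either side. -/
def IsAlgIdeal (I : Submodule F A) : Prop :=
  ∀ x ∈ I, ∀ a : A, a * x ∈ I ∧ x * a ∈ I

/-- The product `I J`: the linear span of all `x * y` with `x ∈ I`, `y ∈ J`. -/
def idealProd (I J : Submodule F A) : Submodule F A :=
  Submodule.span F {z : A | ∃ x ∈ I, ∃ y ∈ J, z = x * y}

variable (A) in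
/-- `A` is prime: the product of any two nonzero ideals is nonzero. -/
def IsPrimeAlg : Prop :=
  ∀ I J : Submodule F A, IsAlgIdeal F I → IsAlgIdeal F J → I ≠ ⊥ → J ≠ ⊥ → idealProd F I J ≠ ⊥

/-- `M` is the unique minimal ideal of `A`: a nonzero ideal contained in every nonzero ideal. -/
def IsUniqueMinimalIdeal (M : Submodule F A) : Prop :=
  IsLeast {I : Submodule F A | IsAlgIdeal F I ∧ I ≠ ⊥} M

/-- A Lie ideal of `A`: a subspace `L` with `[L, A] ⊆ L`, where `⁅x, a⁆ = x * a - a * x`. -/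
def IsLieIdeal (L : Submodule F A) : Prop :=
  ∀ x ∈ L, ∀ a : A, ⁅x, a⁆ ∈ L

/-- A noncentral Lie ideal: a Lie ideal that is not a subset of the center of `A`. -/
def IsNoncentralLieIdeal (L : Submodule F A) : Prop :=
  IsLieIdeal F L ∧ ¬ (L : Set A) ⊆ Set.center A

/-- `[M, A]`: the linear span of all commutators `⁅m, a⁆` with `m ∈ M`, `a ∈ A`. -/
def commutatorSpan (M : Submodule F A) : Submodule F A :=
  Submodule.span F {z : A | ∃ m ∈ M, ∃ a : A, z = ⁅m, a⁆}

end

end HersteinLie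

namespace HersteinLie

section Prime

variable {F : Type*} {A : Type*} [Field F] [NonUnitalRing A] [Module F A]

/-! Let `L` be a noncentral Lie ideal and `T = {x | [x, A] ⊆ L}`. Some `u, v ∈ L` have `[u, v] ≠ 0`:
otherwise `[u, [u, A]] = 0` for all `u ∈ L`, which makes `u` central when the characteristic is not
2. Now `T` is a subalgebra containing `L`, and this forces the ideal `A[u, v]A` into `T`. By
primeness that ideal is nonzero, so it contains `M`, whence `[M, A] ⊆ L`. -/

theorem idealProd_eq_bot {I J : Submodule F A} (h : ∀ x ∈ I, ∀ y ∈ J, x * y = 0) :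
    idealProd F I J = ⊥ := by
  rw [idealProd, Submodule.span_eq_bot]
  rintro _ ⟨x, hx, y, hy, rfl⟩
  exact h x hx y hy

theorem IsAlgIdeal.lie_mem {I : Submodule F A} (hI : IsAlgIdeal F I) {m : A} (hm : m ∈ I)
    (a : A) : ⁅m, a⁆ ∈ I := by
  rw [Ring.lie_def]
  exact sub_mem (hI m hm a).2 (hI m hm a).1

variable [IsScalarTower F A A] [SMulCommClass F A A]

variable (F) in
/-- The span of all `a * x * b`; an ideal, even when `A` has no unit. -/
def sandwichIdeal (x : A) : Submodule F A :=
  Submodule.span F {z : A | ∃ a b : A, z = a * x * b}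

theorem isAlgIdeal_span {s : Set A} (hl : ∀ x ∈ s, ∀ a : A, a * x ∈ Submodule.span F s)
    (hr : ∀ x ∈ s, ∀ a : A, x * a ∈ Submodule.span F s) : IsAlgIdeal F (Submodule.span F s) := by
  intro x hx a
  induction hx using Submodule.span_induction with
  | mem x hx => exact ⟨hl x hx a, hr x hx a⟩
  | zero => simp
  | add x y _ _ hx hy =>
    rw [mul_add, add_mul]
    exact ⟨add_mem hx.1 hy.1, add_mem hx.2 hy.2⟩
  | smul c x _ hx =>
    rw [mul_smul_comm, smul_mul_assoc]
    exact ⟨Submodule.smul_mem _ c hx.1, Submodule.smul_mem _ c hx.2⟩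

theorem isAlgIdeal_sandwichIdeal (x : A) : IsAlgIdeal F (sandwichIdeal F x) := by
  refine isAlgIdeal_span ?_ ?_
  · rintro _ ⟨a, b, rfl⟩ c
    exact Submodule.subset_span ⟨c * a, b, by simp only [mul_assoc]⟩
  · rintro _ ⟨a, b, rfl⟩ c
    exact Submodule.subset_span ⟨a, b * c, by simp only [mul_assoc]⟩

theorem isAlgIdeal_idealProd {I J : Submodule F A} (hI : IsAlgIdeal F I) (hJ : IsAlgIdeal F J) :
    IsAlgIdeal F (idealProd F I J) := by
  refine isAlgIdeal_span ?_ ?_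
  · rintro _ ⟨x, hx, y, hy, rfl⟩ c
    exact Submodule.subset_span ⟨c * x, (hI x hx c).1, y, hy, by simp only [mul_assoc]⟩
  · rintro _ ⟨x, hx, y, hy, rfl⟩ c
    exact Submodule.subset_span ⟨x, hx, y * c, (hJ y hy c).2, by simp only [mul_assoc]⟩

theorem mul_eq_zero_of_mem_span {s t : Set A} (h : ∀ x ∈ s, ∀ y ∈ t, x * y = 0) :
    ∀ x ∈ Submodule.span F s, ∀ y ∈ Submodule.span F t, x * y = 0 := by
  intro x hx y hy
  induction hx, hy using Submodule.span_induction₂ with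
  | mem_mem x y hx hy => exact h x hx y hy
  | zero_left => simp
  | zero_right => simp
  | add_left x y z _ _ _ h₁ h₂ => rw [add_mul, h₁, h₂, add_zero]
  | add_right x y z _ _ _ h₁ h₂ => rw [mul_add, h₁, h₂, add_zero]
  | smul_left c x y _ _ h => rw [smul_mul_assoc, h, smul_zero]
  | smul_right c x y _ _ h => rw [mul_smul_comm, h, smul_zero]

variable (F A) in
/-- The elements `x` with `A x A = 0`. -/
def sandwichAnnihilator : Submodule F A where
  carrier := {x | ∀ a b : A, a * x * b = 0}
  zero_mem' := by simp
  add_mem' := fun {x y} hx hy a b => by rw [mul_add, add_mul, hx, hy, add_zero]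
  smul_mem' := fun c x hx a b => by rw [mul_smul_comm, smul_mul_assoc, hx, smul_zero]

theorem isAlgIdeal_sandwichAnnihilator : IsAlgIdeal F (sandwichAnnihilator F A) := by
  refine fun x hx c => ⟨fun a b => ?_, fun a b => ?_⟩
  · rw [← mul_assoc a c x]
    exact hx (a * c) b
  · rw [← mul_assoc a x c, mul_assoc]
    exact hx a (c * b)

namespace IsPrimeAlg

/-- The annihilator `N` satisfies `N³ = 0`, since `u * v * z = 0` once `v ∈ N`; primeness is applied
twice. This replaces the unit in showing `AxA ≠ 0` for `x ≠ 0`. -/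
theorem sandwichAnnihilator_eq_bot (h : IsPrimeAlg F A) : sandwichAnnihilator F A = ⊥ := by
  by_contra hN
  have hI : IsAlgIdeal F (sandwichAnnihilator F A) := isAlgIdeal_sandwichAnnihilator
  refine h _ _ (isAlgIdeal_idealProd hI hI) hI (h _ _ hI hI hN hN) hN (idealProd_eq_bot ?_)
  intro x hx y hy
  refine mul_eq_zero_of_mem_span (F := F) (t := {y}) ?_ x hx y (Submodule.mem_span_singleton_self y)
  rintro _ ⟨u, -, v, hv, rfl⟩ z -
  exact hv u z

theorem sandwichIdeal_ne_bot (h : IsPrimeAlg F A) {x : A} (hx : x ≠ 0) :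
    sandwichIdeal F x ≠ ⊥ := by
  intro hbot
  rw [sandwichIdeal, Submodule.span_eq_bot] at hbot
  have hmem : x ∈ sandwichAnnihilator F A := fun a b => hbot _ ⟨a, b, rfl⟩
  rw [h.sandwichAnnihilator_eq_bot, Submodule.mem_bot] at hmem
  exact hx hmem

/-- In a prime algebra `x A y = 0` forces `x = 0` or `y = 0`. -/
theorem eq_zero_or_eq_zero (h : IsPrimeAlg F A) {x y : A} (hxy : ∀ a : A, x * a * y = 0) :
    x = 0 ∨ y = 0 := by
  by_contra! hne
  refine h _ _ (isAlgIdeal_sandwichIdeal x) (isAlgIdeal_sandwichIdeal y)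
    (h.sandwichIdeal_ne_bot hne.1) (h.sandwichIdeal_ne_bot hne.2)
    (idealProd_eq_bot (mul_eq_zero_of_mem_span ?_))
  rintro _ ⟨a, b, rfl⟩ _ ⟨c, d, rfl⟩
  calc a * x * b * (c * y * d) = a * (x * (b * c) * y) * d := by simp only [mul_assoc]
    _ = 0 := by rw [hxy, mul_zero, zero_mul]

/-- An element whose inner derivation squares to zero is central. -/
theorem mem_center_of_lie_lie_eq_zero (h : IsPrimeAlg F A) (h2 : (2 : F) ≠ 0) {u : A}
    (hu : ∀ a : A, ⁅u, ⁅u, a⁆⁆ = 0) : u ∈ Set.center A := by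
  -- Leibniz rule for the square of the derivation `[u, ·]`: the cross term carries the factor 2.
  have hmul : ∀ a b : A, ⁅u, a⁆ * ⁅u, b⁆ = 0 := by
    intro a b
    have key : (2 : F) • (⁅u, a⁆ * ⁅u, b⁆) =
        ⁅u, ⁅u, a * b⁆⁆ - ⁅u, ⁅u, a⁆⁆ * b - a * ⁅u, ⁅u, b⁆⁆ := by
      rw [two_smul]
      simp only [Ring.lie_def]
      noncomm_ring
    rw [hu, hu, hu, zero_mul, mul_zero, sub_zero, sub_zero] at key
    exact (smul_eq_zero.mp key).resolve_left h2
  have hsandwich : ∀ a c : A, ⁅u, a⁆ * c * ⁅u, a⁆ = 0 := by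
    intro a c
    have key : ⁅u, a⁆ * c * ⁅u, a⁆ = ⁅u, a⁆ * ⁅u, c * a⁆ - ⁅u, a⁆ * ⁅u, c⁆ * a := by
      simp only [Ring.lie_def]
      noncomm_ring
    rw [key, hmul, hmul, zero_mul, sub_zero]
  rw [Semigroup.mem_center_iff]
  intro a
  have hzero : ⁅u, a⁆ = 0 := (h.eq_zero_or_eq_zero (hsandwich a)).elim id id
  rw [Ring.lie_def, sub_eq_zero] at hzero
  exact hzero.symm

theorem subset_center_of_lie_eq_zero (h : IsPrimeAlg F A) (h2 : (2 : F) ≠ 0)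
    {L : Submodule F A} (hL : IsLieIdeal F L) (hLL : ∀ x ∈ L, ∀ y ∈ L, ⁅x, y⁆ = 0) :
    (L : Set A) ⊆ Set.center A :=
  fun u hu => h.mem_center_of_lie_lie_eq_zero h2 fun a => hLL u hu _ (hL u hu a)

/-- A central ideal of a noncommutative prime algebra is zero. -/
theorem eq_bot_of_subset_center (h : IsPrimeAlg F A) (hnc : ∃ x y : A, x * y ≠ y * x)
    {I : Submodule F A} (hI : IsAlgIdeal F I) (hc : (I : Set A) ⊆ Set.center A) : I = ⊥ := by
  obtain ⟨x, y, hxy⟩ := hnc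
  have hcomm : ∀ m ∈ I, ∀ a : A, a * m = m * a :=
    fun m hm => Semigroup.mem_center_iff.mp (hc hm)
  rw [Submodule.eq_bot_iff]
  intro m hm
  have hkill : ∀ n ∈ I, n * (x * y - y * x) = 0 := by
    intro n hn
    rw [mul_sub, sub_eq_zero, ← mul_assoc, ← mul_assoc, ← hcomm _ (hI n hn x).2 y,
      ← hcomm n hn y, mul_assoc]
  exact (h.eq_zero_or_eq_zero fun a => hkill _ (hI m hm a).2).resolve_right
    (sub_ne_zero.mpr hxy)

end IsPrimeAlg

/-- The elements `x` with `[x, A] ⊆ L`. -/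
def lieTransporter (L : Submodule F A) : Submodule F A where
  carrier := {x | ∀ a : A, ⁅x, a⁆ ∈ L}
  zero_mem' := fun a => by simp [Ring.lie_def]
  add_mem' := fun {x y} hx hy a => by
    have : ⁅x + y, a⁆ = ⁅x, a⁆ + ⁅y, a⁆ := by simp only [Ring.lie_def]; noncomm_ring
    rw [this]
    exact add_mem (hx a) (hy a)
  smul_mem' := fun c x hx a => by
    have : ⁅c • x, a⁆ = c • ⁅x, a⁆ := by
      rw [Ring.lie_def, Ring.lie_def, smul_mul_assoc, mul_smul_comm, smul_sub]
    rw [this]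
    exact Submodule.smul_mem _ c (hx a)

theorem mul_mem_lieTransporter {L : Submodule F A} {x y : A} (hx : x ∈ lieTransporter L)
    (hy : y ∈ lieTransporter L) : x * y ∈ lieTransporter L := by
  intro a
  have key : ⁅x * y, a⁆ = ⁅x, y * a⁆ + ⁅y, a * x⁆ := by
    simp only [Ring.lie_def]
    noncomm_ring
  rw [key]
  exact add_mem (hx _) (hy _)

/-- The Leibniz rule for `[u, v * a]` puts `[u, v]A` in the subalgebra `T`. Left factors then come
for free: moving `b` across an element of `T` costs a commutator in `L ⊆ T`. -/
theorem sandwichIdeal_lie_le_lieTransporter {L : Submodule F A} (hL : IsLieIdeal F L) {u v : A}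
    (hu : u ∈ L) (hv : v ∈ L) : sandwichIdeal F ⁅u, v⁆ ≤ lieTransporter L := by
  have hright : ∀ a : A, ⁅u, v⁆ * a ∈ lieTransporter L := by
    intro a
    have key : ⁅u, v⁆ * a = ⁅u, v * a⁆ - v * ⁅u, a⁆ := by
      simp only [Ring.lie_def]
      noncomm_ring
    rw [key]
    exact sub_mem (hL _ (hL u hu _)) (mul_mem_lieTransporter (hL v hv) (hL _ (hL u hu a)))
  rw [sandwichIdeal, Submodule.span_le]
  rintro _ ⟨b, a, rfl⟩
  have key : b * ⁅u, v⁆ * a = ⁅u, v⁆ * (a * b) - ⁅⁅u, v⁆ * a, b⁆ := by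
    rw [Ring.lie_def (⁅u, v⁆ * a) b]
    noncomm_ring
  rw [key]
  exact sub_mem (hright _) (hL _ (hright a b))

theorem commutatorSpan_le_iff {I L : Submodule F A} :
    commutatorSpan F I ≤ L ↔ I ≤ lieTransporter L := by
  rw [commutatorSpan, Submodule.span_le]
  refine ⟨fun h m hm a => h ⟨m, hm, a, rfl⟩, ?_⟩
  rintro h _ ⟨m, hm, a, rfl⟩
  exact h hm a

theorem IsAlgIdeal.isLieIdeal_commutatorSpan {I : Submodule F A} (hI : IsAlgIdeal F I) :
    IsLieIdeal F (commutatorSpan F I) := by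
  intro x hx a
  have hle : commutatorSpan F I ≤ I :=
    commutatorSpan_le_iff.mpr fun m hm => hI.lie_mem hm
  exact Submodule.subset_span ⟨x, hle hx, a, rfl⟩

/-- If every `[m, a]` is central, it commutes with `m`, so the square-zero criterion makes `I`
central. -/
theorem IsPrimeAlg.not_commutatorSpan_subset_center (h : IsPrimeAlg F A) (h2 : (2 : F) ≠ 0)
    (hnc : ∃ x y : A, x * y ≠ y * x) {I : Submodule F A} (hI : IsAlgIdeal F I) (hne : I ≠ ⊥) :
    ¬ (commutatorSpan F I : Set A) ⊆ Set.center A := by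
  intro hc
  refine hne (h.eq_bot_of_subset_center hnc hI fun m hm => ?_)
  refine h.mem_center_of_lie_lie_eq_zero h2 fun a => ?_
  rw [Ring.lie_def m ⁅m, a⁆, sub_eq_zero]
  exact Semigroup.mem_center_iff.mp (hc (Submodule.subset_span ⟨m, hm, a, rfl⟩)) m

end Prime

end HersteinLie

theorem theorem3p2 {F : Type*} [Field F] (hF : ringChar F ≠ 2)
    {A : Type*} [NonUnitalRing A] [Module F A] [IsScalarTower F A A] [SMulCommClass F A A]
    (hprime : HersteinLie.IsPrimeAlg F A) (hnc : ∃ x y : A, x * y ≠ y * x)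
    (M : Submodule F A) (hM : HersteinLie.IsUniqueMinimalIdeal F M) :
    IsLeast {L : Submodule F A | HersteinLie.IsNoncentralLieIdeal F L}
      (HersteinLie.commutatorSpan F M) := by
  have h2 : (2 : F) ≠ 0 := Ring.two_ne_zero hF
  obtain ⟨⟨hMI, hM0⟩, hMle⟩ := hM
  refine ⟨⟨hMI.isLieIdeal_commutatorSpan,
    hprime.not_commutatorSpan_subset_center h2 hnc hMI hM0⟩, ?_⟩
  rintro L ⟨hL, hLc⟩
  have hLL : ∃ u ∈ L, ∃ v ∈ L, ⁅u, v⁆ ≠ 0 := by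
    by_contra! hzero
    exact hLc (hprime.subset_center_of_lie_eq_zero h2 hL hzero)
  obtain ⟨u, hu, v, hv, huv⟩ := hLL
  exact HersteinLie.commutatorSpan_le_iff.mpr
    ((hMle ⟨HersteinLie.isAlgIdeal_sandwichIdeal _, hprime.sandwichIdeal_ne_bot huv⟩).trans
      (HersteinLie.sandwichIdeal_lie_le_lieTransporter hL hu hv))
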